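/- Let $\mathscr A(\mathbb R)$ be the space of complex-valued real analytic functions on $\mathbb R$, with its natural locally convex inductive limit topology $\mathscr A(\mathbb R)=\operatorname{ind}_{U} H(U)$, where $U$ runs over the open subsets of $\mathbb C$ containing $\mathbb R$ and $H(U)$, the space of holomorphic functions on $U$, carries the compact-open topology. A $C_0$-semigroup on a locally convex space $X$ is a family $(T_t)_{t\ge 0}$ of continuous linear operators on $X$ such that $T_tT_s=T_{t+s}$ for all $t,s\ge 0$, $T_0=I$, and $t\mapsto T_tx$ is continuous on $[0,\infty)$ for every $x\in X$. Its generator is $Ax=\lim_{t\searrow 0}\frac{T_tx-x}{t}$, with domain $D(A)$ the set of all $x\in X$ for which this limit exists. Let $\theta f(x)=xf'(x)$ and let $P(\theta)=\sum_{k=0}^{K}a_k\theta^k$ with $K\ge 2$, $a_0,\dots,a_K\in\mathbb C$ and $a_K\ne 0$. Then $P(\theta)$, with domain $\mathscr A(\mathbb R)$, is not the generator of any $C_0$-semigroup on $\mathscr A(\mathbb R)$ in each of the following cases: (1) there is $l$ with $2\le l\le K$ such that $\operatorname{Re} a_K=\dots=\operatorname{Re} a_{l+1}=0$ and $\operatorname{Re}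 a_l>0$ (for $l=K$ the condition is just $\operatorname{Re} a_K>0$); (2) $a_K,\dots,a_2\in i\mathbb Q$. -/

import Mathlib

open Filter Topology TopologicalSpace Polynomial
open scoped NNReal

/-- The space `𝒜(ℝ)` of complex-valued real analytic functions on the real line, as a
vector space. -/
def realAnalyticSubmodule : Submodule ℂ (ℝ → ℂ) where
  carrier := {f | AnalyticOnNhd ℝ f Set.univ}
  zero_mem' := fun _ _ => analyticAt_const
  add_mem' := fun hf hg => hf.add hg
  smul_mem' := fun c _ hf x hx => (analyticAt_const (v := c)).smul (hf x hx)

/-- The space `𝒜(ℝ)`, as a type of its own: it carries the inductive limit topology defined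
below, and not the topology of pointwise convergence. -/
def RealAnalyticSpace : Type := ↥realAnalyticSubmodule

namespace RealAnalyticSpace

noncomputable instance : AddCommGroup RealAnalyticSpace :=
  inferInstanceAs (AddCommGroup ↥realAnalyticSubmodule)

noncomputable instance : Module ℂ RealAnalyticSpace :=
  inferInstanceAs (Module ℂ ↥realAnalyticSubmodule)

noncomputable instance : Module ℝ RealAnalyticSpace :=
  Module.complexToReal RealAnalyticSpace

/-- The inclusion of `𝒜(ℝ)` into the space of all functions `ℝ → ℂ`. -/
noncomputable def toFunLM : RealAnalyticSpace →ₗ[ℂ] (ℝ → ℂ) := realAnalyticSubmodule.subtype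

noncomputable instance : CoeFun RealAnalyticSpace (fun _ => ℝ → ℂ) := ⟨fun f => toFunLM f⟩

theorem analytic (f : RealAnalyticSpace) : AnalyticOnNhd ℝ f Set.univ := f.2

theorem toFunLM_injective : Function.Injective toFunLM := Subtype.val_injective

/-- The real analytic function given by `f : ℝ → ℂ`. -/
def mk (f : ℝ → ℂ) (hf : AnalyticOnNhd ℝ f Set.univ) : RealAnalyticSpace := ⟨f, hf⟩

end RealAnalyticSpace

/-- The space `H(U)` of holomorphic functions on an open set `U ⊆ ℂ`. As a subspace of `C(U, ℂ)`
it carries the compact-open topology. -/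
def holomorphicSubmodule (U : Opens ℂ) : Submodule ℂ C(U, ℂ) where
  carrier := {f | ∃ g : ℂ → ℂ, DifferentiableOn ℂ g U ∧ ∀ z : U, f z = g z}
  zero_mem' := ⟨0, differentiableOn_const 0, fun _ => rfl⟩
  add_mem' := by
    rintro f₁ f₂ ⟨g₁, hg₁, h₁⟩ ⟨g₂, hg₂, h₂⟩
    exact ⟨g₁ + g₂, hg₁.add hg₂, fun z => by simp [h₁ z, h₂ z]⟩
  smul_mem' := by
    rintro c f ⟨g, hg, h⟩
    exact ⟨c • g, hg.const_smul c, fun z => by simp [h z]⟩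

/-- The restriction map `H(U) → 𝒜(ℝ)`, for an open set `U ⊆ ℂ` that contains the real line. -/
noncomputable def restrictReal (U : Opens ℂ) (hU : ∀ x : ℝ, (x : ℂ) ∈ U) :
    holomorphicSubmodule U →ₗ[ℂ] RealAnalyticSpace where
  toFun f := RealAnalyticSpace.mk (fun x : ℝ => (f : C(U, ℂ)) ⟨(x : ℂ), hU x⟩) (by
    obtain ⟨g, hg, h⟩ := f.2
    intro x _
    have h1 : AnalyticAt ℝ g (x : ℂ) :=
      ((hg.analyticOnNhd U.isOpen) _ (hU x)).restrictScalars
    have h2 : AnalyticAt ℝ (fun y : ℝ => (y : ℂ)) x := Complex.ofRealCLM.analyticAt x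
    have h3 : AnalyticAt ℝ (fun y : ℝ => g (y : ℂ)) x := h1.fun_comp h2
    simpa only [h] using h3)
  map_add' _ _ := rfl
  map_smul' _ _ := rfl

namespace RealAnalyticSpace

/-- The locally convex vector space topologies on `𝒜(ℝ)` for which all the restriction maps
`H(U) → 𝒜(ℝ)`, `U` a complex neighbourhood of `ℝ`, are continuous. -/
def admissibleTopologies : Set (TopologicalSpace RealAnalyticSpace) :=
  {τ | @IsTopologicalAddGroup RealAnalyticSpace τ _ ∧
    @ContinuousSMul ℂ RealAnalyticSpace _ _ τ ∧
    @LocallyConvexSpace ℝ RealAnalyticSpace _ _ _ _ τ ∧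
    ∀ (U : Opens ℂ) (hU : ∀ x : ℝ, (x : ℂ) ∈ U),
      @Continuous (holomorphicSubmodule U) RealAnalyticSpace _ τ (restrictReal U hU)}

/-- The topology of `𝒜(ℝ) = ind_U H(U)`: the locally convex inductive limit topology, i.e. the
finest locally convex topology for which all the restriction maps `H(U) → 𝒜(ℝ)` are continuous
(`sInf` in the order of `TopologicalSpace`, in which finer topologies are smaller). -/
instance : TopologicalSpace RealAnalyticSpace := sInf admissibleTopologies

instance : IsTopologicalAddGroup RealAnalyticSpace :=
  topologicalAddGroup_sInf fun _ h => h.1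

instance : ContinuousSMul ℂ RealAnalyticSpace :=
  continuousSMul_sInf fun _ h => h.2.1

instance : LocallyConvexSpace ℝ RealAnalyticSpace :=
  LocallyConvexSpace.sInf fun _ h => h.2.2.1

theorem continuous_restrictReal (U : Opens ℂ) (hU : ∀ x : ℝ, (x : ℂ) ∈ U) :
    Continuous (restrictReal U hU) :=
  continuous_sInf_rng.2 fun _ h => h.2.2.2 U hU

/-- Point evaluations are continuous; in particular the topology is Hausdorff. -/
theorem continuous_toFunLM : Continuous toFunLM := by
  rw [continuous_iff_le_induced]
  refine sInf_le ⟨topologicalAddGroup_induced toFunLM, continuousSMul_induced toFunLM,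
    LocallyConvexSpace.induced (toFunLM.restrictScalars ℝ), fun U hU => ?_⟩
  rw [continuous_induced_rng]
  refine continuous_pi fun x => ?_
  exact (continuous_eval_const (F := C(U, ℂ)) (⟨(x : ℂ), hU x⟩ : U)).comp continuous_subtype_val

instance : T2Space RealAnalyticSpace :=
  T2Space.of_injective_continuous toFunLM_injective continuous_toFunLM

end RealAnalyticSpace

/-- The Euler operator `θ f (x) = x f'(x)` on `𝒜(ℝ)`. -/
noncomputable def eulerOp : RealAnalyticSpace →ₗ[ℂ] RealAnalyticSpace where
  toFun f := RealAnalyticSpace.mk (fun x : ℝ => (x : ℂ) * deriv f x) (fun x hx =>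
    (Complex.ofRealCLM.analyticAt x).mul (f.analytic.deriv x hx))
  map_add' f g := by
    apply RealAnalyticSpace.toFunLM_injective
    funext x
    have h : deriv (f + g : RealAnalyticSpace) x = deriv f x + deriv g x := by
      rw [map_add]
      exact deriv_add (f.analytic x trivial).differentiableAt
        (g.analytic x trivial).differentiableAt
    change (x : ℂ) * deriv (f + g : RealAnalyticSpace) x
      = (x : ℂ) * deriv f x + (x : ℂ) * deriv g x
    rw [h, mul_add]
  map_smul' c f := by
    apply RealAnalyticSpace.toFunLM_injective
    funext x
    have h : deriv (c • f : RealAnalyticSpace) x = c * deriv f x := by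
      rw [map_smul]
      exact deriv_const_smul c (f.analytic x trivial).differentiableAt
    change (x : ℂ) * deriv (c • f : RealAnalyticSpace) x = c * ((x : ℂ) * deriv f x)
    rw [h]
    ring

/-- A `C₀`-semigroup `(T_t)_{t ≥ 0}` of continuous linear operators on a topological vector
space: `T_t T_s = T_{t+s}`, `T_0 = I`, and `t ↦ T_t x` is continuous on `[0, ∞)` for every `x`. -/
structure C0Semigroup (X : Type*) [AddCommGroup X] [Module ℂ X] [TopologicalSpace X] where
  /-- the operators of the semigroup -/
  op : ℝ≥0 → X →L[ℂ] X
  op_comp : ∀ t s, (op t).comp (op s) = op (t + s)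
  op_zero : op 0 = ContinuousLinearMap.id ℂ X
  continuous_orbit : ∀ x, Continuous fun t => op t x

namespace C0Semigroup

variable {X : Type*} [AddCommGroup X] [Module ℂ X] [TopologicalSpace X]

/-- The graph of the generator `(A, D(A))`: all pairs `(x, y)` such that
`(T_t x - x) / t → y` as `t → 0`, `t > 0`. -/
def generatorGraph (T : C0Semigroup X) : Set (X × X) :=
  {p | Tendsto (fun t : ℝ≥0 => ((t : ℝ) : ℂ)⁻¹ • (T.op t p.1 - p.1)) (𝓝[>] 0) (𝓝 p.2)}

/-- The everywhere defined operator `M` is the generator of the semigroup: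
`D(A) = X` and `A = M`. -/
def IsGeneratedBy (T : C0Semigroup X) (M : X →ₗ[ℂ] X) : Prop :=
  T.generatorGraph = {p | p.2 = M p.1}

end C0Semigroup

/-- The operator `M` generates a `C₀`-semigroup on `X`. -/
def GeneratesC0Semigroup {X : Type*} [AddCommGroup X] [Module ℂ X] [TopologicalSpace X]
    (M : X →ₗ[ℂ] X) : Prop :=
  ∃ T : C0Semigroup X, T.IsGeneratedBy M

/-! Taylor coefficients at `0` are continuous eigenfunctionals of `P(θ)` with eigenvalue `P(n)`, so
a semigroup generated by `P(θ)` multiplies the `n`-th coefficient by `exp (t P(n))`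
(`IsGeneratedBy.apply_op_eq_exp`). In both cases this multiplier creates a singularity on the unit
circle at the real point `1`, which `sum_taylorCoeff_eq_zero` forbids.

Case (1): `exp (-P(n))` are the coefficients of an entire function, which `T_1` would send to `1 /
(1 - x)`.

Case (2): for suitable `t` the multiplier is a constant times `b ^ n * u n`, with `u` periodic of
period `M`. Applied to `1 / (1 - (ζ / b) x)`, where `ζ ^ M = 1` and `ζ / b` is not real, it gives
periodic coefficients, so the discrete Fourier transform of `u` vanishes at `ζ`. Only roots of unity
on the real line through `b` escape, and these share one square `c`. Hence `u n = c * u (n + 2)`,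
which is impossible for large `M`, as the quadratic or higher phase of `u` has nonconstant
increments. -/

namespace RealAnalyticSpace

/-! ### Taylor coefficients as continuous functionals -/

/-- A linear functional on `𝒜(ℝ)` is continuous if it is so on every `H(U)`. -/
theorem continuous_of_comp_restrictReal (L : RealAnalyticSpace →ₗ[ℂ] ℂ)
    (hL : ∀ (U : Opens ℂ) (hU : ∀ x : ℝ, (x : ℂ) ∈ U), Continuous (L ∘ₗ restrictReal U hU)) :
    Continuous L := by
  rw [continuous_iff_le_induced]
  refine sInf_le ⟨topologicalAddGroup_induced L, continuousSMul_induced L,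
    LocallyConvexSpace.induced (L.restrictScalars ℝ), fun U hU => ?_⟩
  rw [continuous_induced_rng]
  exact hL U hU

theorem contDiff (f : RealAnalyticSpace) {n : WithTop ℕ∞} : ContDiff ℝ n f := by
  rw [← contDiffOn_univ]
  exact f.analytic.contDiffOn uniqueDiffOn_univ

/-- The `n`-th Taylor coefficient at the origin, as a linear functional on `𝒜(ℝ)`. -/
noncomputable def taylorCoeff (n : ℕ) : RealAnalyticSpace →ₗ[ℂ] ℂ where
  toFun f := iteratedDeriv n f 0 / n.factorial
  map_add' f g := by
    rw [map_add, iteratedDeriv_add f.contDiff.contDiffAt g.contDiff.contDiffAt, add_div]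
  map_smul' c f := by
    rw [map_smul, iteratedDeriv_const_smul_field, smul_div_assoc, RingHom.id_apply]

theorem taylorCoeff_apply (n : ℕ) (f : RealAnalyticSpace) :
    taylorCoeff n f = iteratedDeriv n f 0 / n.factorial := rfl

end RealAnalyticSpace

theorem iteratedDeriv_comp_ofReal {U : Opens ℂ} (hU : ∀ x : ℝ, (x : ℂ) ∈ U) {g : ℂ → ℂ}
    (hg : DifferentiableOn ℂ g U) (n : ℕ) (x : ℝ) :
    iteratedDeriv n (fun y : ℝ => g y) x = iteratedDeriv n g x := by
  induction n generalizing x with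
  | zero => simp
  | succ n ih =>
    rw [iteratedDeriv_succ, iteratedDeriv_succ, funext ih]
    refine HasDerivAt.deriv (HasDerivAt.comp_ofReal ?_)
    have h : AnalyticOnNhd ℂ (iteratedDeriv n g) U := by
      rw [iteratedDeriv_eq_iterate]
      exact (hg.analyticOnNhd U.isOpen).iterated_deriv n
    exact (h _ (hU x)).differentiableAt.hasDerivAt

namespace RealAnalyticSpace

/-- Cauchy's estimate on a circle inside `U` bounds the coefficient by a supremum over a compact
set. -/
theorem continuous_taylorCoeff (n : ℕ) : Continuous (taylorCoeff n) := by
  refine continuous_of_comp_restrictReal _ fun U hU => ?_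
  refine continuous_of_continuousAt_zero _ ?_
  obtain ⟨r, hr, hrU⟩ := Metric.nhds_basis_closedBall.mem_iff.1 (U.isOpen.mem_nhds (hU 0))
  rw [Complex.ofReal_zero] at hrU
  rw [ContinuousAt, map_zero, Metric.tendsto_nhds]
  intro ε hε
  have hK : IsCompact {z : U | (z : ℂ) ∈ Metric.sphere (0 : ℂ) r} := by
    rw [Subtype.isCompact_iff]
    convert isCompact_sphere (0 : ℂ) r
    ext z
    simp only [Set.mem_image, Set.mem_ofPred_eq, Subtype.exists, exists_and_left, exists_prop,
      exists_eq_right_right, and_iff_left_iff_imp]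
    exact fun hz => hrU (Metric.sphere_subset_closedBall hz)
  -- With this bound on the circle, Cauchy's estimate gives `η / r ^ n = ε / 2`.
  set η := ε * r ^ n / 2 with hη
  have hη0 : 0 < η := by positivity
  have hopen := ContinuousMap.isOpen_setOfPred_mapsTo hK (Metric.isOpen_ball (x := (0 : ℂ)) (ε := η))
  have hmem := (hopen.preimage continuous_subtype_val).mem_nhds
    (x := (0 : holomorphicSubmodule U)) (fun z _ => by simpa using hη0)
  filter_upwards [hmem] with f hf
  obtain ⟨g, hg, hfg⟩ := f.2
  have h1 : toFunLM (restrictReal U hU f) = fun x : ℝ => g x := funext fun x => hfg _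
  have hb := Complex.norm_iteratedDeriv_le_of_forall_mem_sphere_norm_le (c := (0 : ℂ)) (C := η)
    (f := g) n hr ((hg.mono hrU).diffContOnCl_ball le_rfl) (fun z hz => by
      have hzU := hrU (Metric.sphere_subset_closedBall hz)
      have := hf (x := ⟨z, hzU⟩) hz
      rw [hfg, mem_ball_zero_iff] at this
      exact this.le)
  have h2 := iteratedDeriv_comp_ofReal hU hg n 0
  rw [LinearMap.comp_apply, taylorCoeff_apply, h1, h2, dist_zero_right, norm_div,
    Complex.norm_natCast, Complex.ofReal_zero]
  have hn : (0 : ℝ) < n.factorial := by positivity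
  calc _ ≤ (n.factorial * η / r ^ n) / n.factorial := by gcongr
    _ = ε / 2 := by rw [hη]; field_simp
    _ < ε := by linarith

/-! ### Action of the Euler operator on Taylor coefficients -/

theorem iteratedDeriv_eulerOp (f : RealAnalyticSpace) (n : ℕ) (x : ℝ) :
    iteratedDeriv n (eulerOp f) x = x * iteratedDeriv (n + 1) f x + n * iteratedDeriv n f x := by
  induction n generalizing x with
  | zero =>
    simp only [iteratedDeriv_zero, zero_add, iteratedDeriv_one, Nat.cast_zero, zero_mul, add_zero]
    rfl
  | succ n ih =>
    rw [iteratedDeriv_succ, funext ih]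
    have hd (k : ℕ) : HasDerivAt (iteratedDeriv k f) (iteratedDeriv (k + 1) f x) x := by
      rw [iteratedDeriv_succ]
      exact (f.contDiff.differentiable_iteratedDeriv k
        (WithTop.coe_lt_top _)).differentiableAt.hasDerivAt
    have := ((Complex.ofRealCLM.hasDerivAt (x := x)).mul (hd (n + 1))).add
      ((hd n).const_mul (n : ℂ))
    refine (HasDerivAt.deriv this).trans ?_
    simp only [Complex.ofRealCLM_apply]
    push_cast
    ring

theorem taylorCoeff_eulerOp (f : RealAnalyticSpace) (n : ℕ) :
    taylorCoeff n (eulerOp f) = n * taylorCoeff n f := by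
  rw [taylorCoeff_apply, taylorCoeff_apply, iteratedDeriv_eulerOp]
  simp [mul_div_assoc]

theorem taylorCoeff_aeval_eulerOp (P : ℂ[X]) (f : RealAnalyticSpace) (n : ℕ) :
    taylorCoeff n (aeval (R := ℂ) (A := Module.End ℂ RealAnalyticSpace) eulerOp P f)
      = P.eval (n : ℂ) * taylorCoeff n f := by
  induction P using Polynomial.induction_on generalizing f with
  | C a => simp [Module.algebraMap_end_apply]
  | add p q hp hq => simp [hp, hq, add_mul]
  | monomial k a h =>
    rw [pow_succ, ← mul_assoc, map_mul, Module.End.mul_apply, h, aeval_X, taylorCoeff_eulerOp]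
    simp
    ring

/-! ### Functions and their Taylor coefficients -/

/-- A holomorphic function near the real line gives an element of `𝒜(ℝ)` with the same Taylor
coefficients at the origin. -/
theorem exists_taylorCoeff_eq {U : Opens ℂ} (hU : ∀ x : ℝ, (x : ℂ) ∈ U) {g : ℂ → ℂ}
    (hg : DifferentiableOn ℂ g U) {c : ℕ → ℂ}
    (hc : ∀ᶠ z in 𝓝 (0 : ℂ), HasSum (fun n => z ^ n * c n) (g z)) :
    ∃ f : RealAnalyticSpace, ∀ n, taylorCoeff n f = c n := by
  refine ⟨restrictReal U hU ⟨⟨fun z => g z, hg.continuousOn.domRestrict⟩, g, hg, fun _ => rfl⟩,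
    fun n => ?_⟩
  have h1 : HasFPowerSeriesAt g (FormalMultilinearSeries.ofScalars ℂ c) 0 := by
    rw [hasFPowerSeriesAt_iff]
    simpa [FormalMultilinearSeries.coeff_ofScalars] using hc
  have h0 : (0 : ℂ) ∈ (U : Set ℂ) := by simpa using hU 0
  have h2 := (hg.analyticOnNhd U.isOpen 0 h0).hasFPowerSeriesAt.eq_formalMultilinearSeries h1
  have h3 := congrArg (fun p => FormalMultilinearSeries.coeff p n) h2
  simp only [FormalMultilinearSeries.coeff_ofScalars] at h3
  rw [← h3, taylorCoeff_apply]
  congr 1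
  exact iteratedDeriv_comp_ofReal hU hg n 0

theorem eventually_hasSum_taylorCoeff (f : RealAnalyticSpace) :
    ∀ᶠ x : ℝ in 𝓝 0, HasSum (fun n => (x : ℂ) ^ n * taylorCoeff n f) (f x) := by
  obtain ⟨p, r, hp⟩ := f.analytic 0 trivial
  filter_upwards [Metric.eball_mem_nhds (0 : ℝ) hp.r_pos] with x hx
  have := hp.hasSum_iteratedFDeriv hx
  rw [zero_add] at this
  convert! this using 2 with n
  rw [iteratedFDeriv_apply_eq_iteratedDeriv_mul_prod, taylorCoeff_apply]
  simp [div_eq_inv_mul, mul_left_comm]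

/-- The Taylor coefficients of a function in `𝒜(ℝ)` cannot be periodic, except if they add up
to zero over a period. -/
theorem sum_taylorCoeff_eq_zero {f : RealAnalyticSpace} {M : ℕ}
    (hf : ∀ n, taylorCoeff (n + M) f = taylorCoeff n f) :
    ∑ n ∈ Finset.range M, taylorCoeff n f = 0 := by
  have h1 : AnalyticOnNhd ℝ (fun x : ℝ => (1 - (x : ℂ) ^ M) * f x) Set.univ := fun x hx =>
    (analyticAt_const.sub ((Complex.ofRealCLM.analyticAt x).pow M)).mul (f.analytic x hx)
  have h2 : AnalyticOnNhd ℝ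
      (fun x : ℝ => ∑ n ∈ Finset.range M, (x : ℂ) ^ n * taylorCoeff n f) Set.univ := fun x hx =>
    Finset.analyticAt_fun_sum _ fun n _ =>
      ((Complex.ofRealCLM.analyticAt x).pow n).mul analyticAt_const
  -- The power series gives the identity near `0` only; analyticity carries it to `x = 1`, where the
  -- factor `1 - x ^ M` vanishes.
  have h3 := h1.eq_of_eventuallyEq h2 (z₀ := 0) (by
    filter_upwards [f.eventually_hasSum_taylorCoeff] with x hx
    have h := hx.summable.sum_add_tsum_nat_add M
    simp_rw [hf, pow_add, mul_right_comm _ ((x : ℂ) ^ M), tsum_mul_right, hx.tsum_eq] at h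
    linear_combination -h)
  simpa using (congrFun h3 1).symm

end RealAnalyticSpace

/-! ### Eigenfunctionals of a generator -/

namespace C0Semigroup

theorem op_add_apply {X : Type*} [AddCommGroup X] [Module ℂ X] [TopologicalSpace X]
    (T : C0Semigroup X) (t s : ℝ≥0) (x : X) : T.op (t + s) x = T.op t (T.op s x) := by
  rw [← T.op_comp]; rfl

/-- An eigenfunctional of an everywhere defined generator is an eigenfunctional of the
semigroup. -/
theorem IsGeneratedBy.apply_op_eq_exp {X : Type*} [AddCommGroup X] [Module ℂ X]
    [TopologicalSpace X] {T : C0Semigroup X} {A : X →ₗ[ℂ] X} (hT : T.IsGeneratedBy A)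
    {L : X →ₗ[ℂ] ℂ} (hL : Continuous L) {c : ℂ} (hLA : ∀ x, L (A x) = c * L x) (t : ℝ≥0) (x : X) :
    L (T.op t x) = Complex.exp (t * c) * L x := by
  have hgen (y : X) : Tendsto (fun s : ℝ≥0 => ((s : ℝ) : ℂ)⁻¹ • (T.op s y - y)) (𝓝[>] 0)
      (𝓝 (A y)) := by
    have : (y, A y) ∈ T.generatorGraph := by rw [hT]; rfl
    exact this
  set v : ℝ → ℂ := fun s => L (T.op s.toNNReal x) with hv
  have hvc : Continuous v := hL.comp ((T.continuous_orbit x).comp continuous_real_toNNReal)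
  have hvd (s : ℝ) (hs : 0 ≤ s) : HasDerivWithinAt v (c * v s) (Set.Ici s) s := by
    rw [hasDerivWithinAt_iff_tendsto_slope, Set.Ici_sdiff_left]
    have h1 : Tendsto (fun r : ℝ => (r - s).toNNReal) (𝓝[>] s) (𝓝[>] 0) := by
      refine tendsto_nhdsWithin_iff.2 ⟨?_, ?_⟩
      · have : Continuous fun r : ℝ => (r - s).toNNReal := by fun_prop
        simpa using (this.tendsto s).mono_left nhdsWithin_le_nhds
      · filter_upwards [self_mem_nhdsWithin] with r hr
        simpa using hr
    have h2 := (hL.tendsto _).comp ((hgen (T.op s.toNNReal x)).comp h1)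
    rw [hLA] at h2
    refine h2.congr' ?_
    filter_upwards [self_mem_nhdsWithin] with r hr
    have hr' : 0 ≤ r - s := sub_nonneg.2 (le_of_lt hr)
    simp only [Function.comp_apply, ← T.op_add_apply, hv]
    rw [← Real.toNNReal_add hr' hs, sub_add_cancel, map_smul, map_sub, slope_def_module,
      Real.coe_toNNReal _ hr', ← Complex.ofReal_inv]
    rfl
  -- The generator controls right derivatives only; with continuity of the orbit this suffices.
  have hw := constant_of_has_deriv_right_zero (f := fun s : ℝ => Complex.exp (-(s * c)) * v s)
    (a := 0) (b := t) (by fun_prop) (fun s hs => by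
      have he : HasDerivAt (fun s : ℝ => Complex.exp (-(s * c))) (Complex.exp (-(s * c)) * -c) s := by
        have := (((Complex.ofRealCLM.hasDerivAt (x := s)).mul_const c).neg).cexp
        simpa using this
      have := he.hasDerivWithinAt.mul (hvd s hs.1)
      convert! this using 1
      ring) t ⟨t.2, le_rfl⟩
  simp only [hv, Complex.ofReal_zero, zero_mul, neg_zero, Complex.exp_zero, Real.toNNReal_zero,
    T.op_zero, one_mul, Real.toNNReal_coe, ContinuousLinearMap.id_apply] at hw
  rw [← hw, ← mul_assoc, ← Complex.exp_add]
  simp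

end C0Semigroup

/-! ### Test functions -/

/-- If the real parts of the coefficients of `P` have a positive leading term of degree at least
two, then `Re P(n)` grows faster than any linear function. -/
theorem Polynomial.tendsto_re_eval_sub_mul_atTop {P : ℂ[X]} {l : ℕ} (hl : 2 ≤ l)
    (hpos : 0 < (P.coeff l).re) (hzero : ∀ k, l < k → (P.coeff k).re = 0) (b : ℝ) :
    Tendsto (fun n : ℕ => (P.eval (n : ℂ)).re - b * n) atTop atTop := by
  set Q : ℝ[X] := (∑ k ∈ Finset.range (P.natDegree + 1), C (P.coeff k).re * X ^ k) - C b * X with hQ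
  have hcoeff (k : ℕ) (hk : 2 ≤ k) : Q.coeff k = (P.coeff k).re := by
    have h1 : k ≠ 1 := by omega
    simp only [hQ, coeff_sub, finsetSum_coeff, coeff_C_mul, coeff_X, coeff_X_pow,
      if_neg h1.symm, mul_ite, mul_one, mul_zero, sub_zero, Finset.sum_ite_eq, Finset.mem_range]
    split_ifs with h
    · rfl
    · rw [coeff_eq_zero_of_natDegree_lt (by omega), Complex.zero_re]
  have hdeg : Q.natDegree = l := by
    refine natDegree_eq_of_le_of_coeff_ne_zero ?_ (by rw [hcoeff l hl]; exact hpos.ne')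
    exact natDegree_le_iff_coeff_eq_zero.2 fun k hk => by
      rw [hcoeff k (by omega), hzero k hk]
  have hQt := (Q.tendsto_atTop_of_leadingCoeff_nonneg
    (natDegree_pos_iff_degree_pos.1 (by omega))
    (by rw [leadingCoeff, hdeg, hcoeff l hl]; exact hpos.le)).comp tendsto_natCast_atTop_atTop
  refine hQt.congr fun n => ?_
  simp only [Function.comp_apply, hQ, eval_sub, eval_finsetSum, eval_mul, eval_C, eval_pow, eval_X]
  rw [eval_eq_sum_range, Complex.re_sum]
  congr 1
  refine Finset.sum_congr rfl fun k _ => ?_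
  rw [← Nat.cast_pow, ← Nat.cast_pow, ← Complex.ofReal_natCast, Complex.re_mul_ofReal]

open RealAnalyticSpace

/-- The entire function with the rapidly decreasing Taylor coefficients `exp (-P(n))`. -/
theorem exists_taylorCoeff_eq_exp_neg_eval {P : ℂ[X]} {l : ℕ} (hl : 2 ≤ l)
    (hpos : 0 < (P.coeff l).re) (hzero : ∀ k, l < k → (P.coeff k).re = 0) :
    ∃ f : RealAnalyticSpace, ∀ n, taylorCoeff n f = Complex.exp (-P.eval (n : ℂ)) := by
  set c : ℕ → ℂ := fun n => Complex.exp (-P.eval (n : ℂ))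
  have hrad : (FormalMultilinearSeries.ofScalars ℂ c).radius = ⊤ := by
    refine FormalMultilinearSeries.radius_eq_top_of_summable_norm _ fun r => ?_
    have hs : Summable fun n : ℕ => Real.exp (-(1 : ℝ)) ^ n :=
      summable_geometric_of_lt_one (Real.exp_pos _).le (by simp)
    refine hs.of_norm_bounded_eventually_nat ?_
    -- The slope `1 + r` absorbs `r ^ n ≤ exp (n * r)` and leaves the summable `exp (-n)`.
    filter_upwards [(tendsto_re_eval_sub_mul_atTop hl hpos hzero (1 + r)).eventually_ge_atTop 0]
      with n hn
    have h1 : (r : ℝ) ≤ Real.exp r := by linarith [Real.add_one_le_exp (r : ℝ)]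
    rw [FormalMultilinearSeries.ofScalars_norm, norm_mul, norm_norm, norm_pow, Complex.norm_exp,
      NNReal.norm_eq]
    calc _ ≤ Real.exp (-P.eval (n : ℂ)).re * Real.exp r ^ n := by gcongr
      _ = Real.exp (-(P.eval (n : ℂ)).re + n * r) := by
        rw [← Real.exp_nat_mul, ← Real.exp_add, Complex.neg_re]
      _ ≤ Real.exp (n * -1) := Real.exp_le_exp.2 (by linarith)
      _ = _ := Real.exp_nat_mul _ _
  have hball := (FormalMultilinearSeries.ofScalars ℂ c).hasFPowerSeriesOnBall (by simp [hrad])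
  rw [hrad] at hball
  refine exists_taylorCoeff_eq (U := ⊤) (fun _ => trivial)
    (g := (FormalMultilinearSeries.ofScalars ℂ c).sum) ?_ ?_
  · intro z _
    exact (hball.analyticAt_of_mem (by simp)).differentiableAt.differentiableWithinAt
  · have := hasFPowerSeriesAt_iff.1 hball.hasFPowerSeriesAt
    simpa [FormalMultilinearSeries.coeff_ofScalars] using this

/-- The functions `x ↦ 1 / (1 - a x)` for nonreal `a`. -/
theorem exists_taylorCoeff_eq_pow {a : ℂ} (ha : a.im ≠ 0) :
    ∃ f : RealAnalyticSpace, ∀ n, taylorCoeff n f = a ^ n := by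
  have ho : IsOpen {z : ℂ | 1 - a * z ≠ 0} := isOpen_ne_fun (by fun_prop) (by fun_prop)
  refine exists_taylorCoeff_eq (U := ⟨_, ho⟩) (g := fun z => (1 - a * z)⁻¹) (fun x hx => ?_)
    (fun z hz => ?_) ?_
  · have him := congrArg Complex.im hx
    have hre := congrArg Complex.re hx
    simp [ha] at him
    simp [him] at hre
  · exact DifferentiableAt.differentiableWithinAt (by fun_prop (disch := exact hz))
  · have h : ∀ᶠ z in 𝓝 (0 : ℂ), ‖a * z‖ < 1 :=
      (Continuous.tendsto' (by fun_prop) (0 : ℂ) _ (by simp)).eventually_lt_const one_pos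
    filter_upwards [h] with z hz
    simpa [mul_pow, mul_comm] using hasSum_geometric_of_norm_lt_one hz

/-! ### Periodic sequences and the arithmetic of the phase -/

theorem Finset.sum_range_succ_shift_of_eq {A : Type*} [AddCommGroup A] {g : ℕ → A} {M : ℕ}
    (h : g M = g 0) : ∑ n ∈ Finset.range M, g (n + 1) = ∑ n ∈ Finset.range M, g n := by
  have := (Finset.sum_range_succ g M).symm.trans (Finset.sum_range_succ' g M)
  rw [h] at this
  exact (add_right_cancel this).symm

/-- An `M`-periodic sequence `u` whose discrete Fourier transform vanishes except at the roots of
unity with square `c` satisfies `u n = c * u (n + 2)`. -/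
theorem eq_mul_shift_two_of_periodic {u : ℕ → ℂ} {M : ℕ} (hu : ∀ n, u (n + M) = u n)
    {c : ℂ} (h : ∀ ζ : ℂ, ζ ^ M = 1 →
      (ζ ^ 2 - c) * ∑ n ∈ Finset.range M, u n * ζ ^ n = 0) {n : ℕ} (hn : n < M) :
    u n = c * u (n + 2) := by
  have hM : M ≠ 0 := by omega
  have hζ := Complex.isPrimitiveRoot_exp M hM
  set p : ℂ[X] := ∑ n ∈ Finset.range M, C (u n - c * u (n + 2)) * X ^ n with hp
  -- Shifting the sums by periodicity turns `ζ ^ 2 * p(ζ)` into the expression in `h`, so `p`, of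
  -- degree below `M`, has all `M` roots of unity as roots.
  have hp0 : p = 0 := by
    refine eq_zero_of_natDegree_lt_card_of_eval_eq_zero' p (nthRootsFinset M (1 : ℂ)) ?_ ?_
    · intro ζ h1
      rw [mem_nthRootsFinset (by omega)] at h1
      have hζ0 : ζ ≠ 0 := by rintro rfl; simp [hM] at h1
      have e1 := Finset.sum_range_succ_shift_of_eq (g := fun n => u n * ζ ^ n) (M := M)
        (by simpa [h1] using hu 0)
      have e2 := Finset.sum_range_succ_shift_of_eq (g := fun n => u (n + 1) * ζ ^ (n + 1)) (M := M)
        (by simpa [h1, pow_succ, add_comm] using Or.inl (hu 1))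
      have e3 : ζ ^ 2 * eval ζ p = 0 := by
        rw [← h ζ h1, hp, eval_finsetSum, sub_mul]
        simp only [eval_mul, eval_C, eval_pow, eval_X, sub_mul, Finset.sum_sub_distrib, mul_sub]
        congr 1
        rw [← e1, ← e2, Finset.mul_sum, Finset.mul_sum]
        exact Finset.sum_congr rfl fun k _ => by ring
      exact (mul_eq_zero.1 e3).resolve_left (pow_ne_zero 2 hζ0)
    · rw [hζ.card_nthRootsFinset]
      refine (natDegree_sum_le_of_forall_le (n := M - 1) _ _ fun k hk => ?_).trans_lt (by omega)
      rw [Finset.mem_range] at hk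
      exact (natDegree_C_mul_X_pow_le _ _).trans (by omega)
  have hc := congrArg (fun r => coeff r n) hp0
  simp only [hp, finsetSum_coeff, coeff_C_mul, coeff_X_pow, mul_ite, mul_one, mul_zero,
    Finset.sum_ite_eq, Finset.mem_range, if_pos hn, coeff_zero] at hc
  exact sub_eq_zero.1 hc

/-- For a polynomial of degree at least two, the increments over steps of length two are not
constant. -/
theorem Polynomial.exists_eval_add_two_sub_ne {Q : ℚ[X]} (hQ : 2 ≤ Q.natDegree) :
    ∃ n : ℕ, Q.eval ((n : ℚ) + 2) - Q.eval (n : ℚ) ≠ Q.eval 2 - Q.eval 0 := by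
  by_contra! h
  -- Constant increments make `Q(2X)` affine, against the degree of `Q`.
  have h1 (n : ℕ) : Q.eval (2 * (n : ℚ)) = Q.eval 0 + n * (Q.eval 2 - Q.eval 0) := by
    induction n with
    | zero => simp
    | succ n ih =>
      have := h (2 * n)
      push_cast at this ⊢
      rw [mul_add, mul_one]
      linarith
  have h2 : Q.comp (C 2 * X) = C (Q.eval 0) + X * C (Q.eval 2 - Q.eval 0) := by
    refine eq_of_infinite_eval_eq _ _ ((Set.infinite_range_of_injective
      (Nat.cast_injective (R := ℚ))).mono ?_)
    rintro _ ⟨n, rfl⟩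
    simp [h1]
  have h3 := congrArg natDegree h2
  rw [natDegree_comp, natDegree_C_mul_X _ two_ne_zero, mul_one] at h3
  have h4 : (C (Q.eval 0) + X * C (Q.eval 2 - Q.eval 0)).natDegree ≤ 1 := by compute_degree
  omega

/-- A rational polynomial takes values with a common denominator, the numerators being values of
an integer polynomial. -/
theorem Polynomial.exists_int_eval_eq_mul (Q : ℚ[X]) :
    ∃ (E : ℕ) (R : ℤ[X]), 0 < E ∧ ∀ n : ℕ, ((R.eval (n : ℤ) : ℤ) : ℚ) = E * Q.eval (n : ℚ) := by
  obtain ⟨b, hb, h⟩ := IsLocalization.integerNormalization_spec (nonZeroDivisors ℤ) Q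
  have hb0 : b ≠ 0 := nonZeroDivisors.ne_zero hb
  refine ⟨b.natAbs, C b.sign * IsLocalization.integerNormalization (nonZeroDivisors ℤ) Q,
    Int.natAbs_pos.2 hb0, fun n => ?_⟩
  have h1 := congrArg (eval (n : ℚ)) h
  rw [eval_smul, eval_natCast_map, zsmul_eq_mul] at h1
  rw [eval_mul, eval_C, Int.cast_mul]
  simp only [algebraMap_int_eq, eq_intCast] at h1
  rw [h1, ← mul_assoc, ← Int.cast_mul, Int.sign_mul_self_eq_natAbs, Int.cast_natCast]

/-- The exponentials `exp (2πi R(n) / M)` are periodic. -/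
theorem exp_eval_div_periodic (R : ℤ[X]) {M : ℕ} (hM : M ≠ 0) (n : ℕ) :
    Complex.exp (2 * Real.pi * Complex.I * ((R.eval ((n + M : ℕ) : ℤ) : ℤ) / M))
      = Complex.exp (2 * Real.pi * Complex.I * ((R.eval (n : ℤ) : ℤ) / M)) := by
  obtain ⟨k, hk⟩ := R.sub_dvd_eval_sub ((n + M : ℕ) : ℤ) (n : ℤ)
  rw [Complex.exp_eq_exp_iff_exists_int]
  refine ⟨k, ?_⟩
  have hk' : R.eval ((n + M : ℕ) : ℤ) = R.eval (n : ℤ) + M * k := by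
    push_cast at hk ⊢
    linear_combination hk
  have hM' : (M : ℂ) ≠ 0 := by exact_mod_cast hM
  rw [hk']
  push_cast
  field_simp

theorem exists_sq_eq_of_im_eq_zero {b : ℂ} (hb : b ≠ 0) {M : ℕ} (hM : M ≠ 0) :
    ∃ c : ℂ, ∀ ζ : ℂ, ζ ^ M = 1 → (ζ / b).im = 0 → ζ ^ 2 = c := by
  -- If `ζ = r * b` with `r` real, then `|ζ| = 1` forces `r ^ 2 = 1 / ‖b‖ ^ 2`.
  refine ⟨b ^ 2 / (‖b‖ : ℂ) ^ 2, fun ζ hζ him => ?_⟩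
  have h1 : ‖ζ‖ = 1 := Complex.norm_eq_one_of_pow_eq_one hζ hM
  obtain ⟨r, hr⟩ : ∃ r : ℝ, ζ / b = r := ⟨_, (Complex.ext rfl (by simpa using him))⟩
  have h2 : ‖b‖ ≠ 0 := norm_ne_zero_iff.2 hb
  have h3 : |r| * ‖b‖ = 1 := by
    rw [← Real.norm_eq_abs, ← Complex.norm_real, ← hr, norm_div, div_mul_cancel₀ _ h2, h1]
  have h4 : r ^ 2 * ‖b‖ ^ 2 = 1 := by rw [← sq_abs, ← mul_pow, h3, one_pow]
  have h5 : (r : ℂ) ^ 2 * (‖b‖ : ℂ) ^ 2 = 1 := by exact_mod_cast h4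
  have h6 : (‖b‖ : ℂ) ≠ 0 := by exact_mod_cast h2
  rw [(div_eq_iff hb).1 hr, eq_div_iff (pow_ne_zero 2 h6)]
  linear_combination b ^ 2 * h5

/-! ### The two cases -/

theorem not_generatesC0Semigroup_of_rational {P : ℂ[X]} (hP : 2 ≤ P.natDegree)
    (h : ∀ k, 2 ≤ k → ∃ q : ℚ, P.coeff k = Complex.I * (q : ℂ)) :
    ¬ GeneratesC0Semigroup (aeval (R := ℂ) (A := Module.End ℂ RealAnalyticSpace) eulerOp P) := by
  rintro ⟨T, hT⟩
  obtain ⟨Q, hQd, hQ⟩ : ∃ Q : ℚ[X], 2 ≤ Q.natDegree ∧ ∀ n : ℕ,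
      P.eval (n : ℂ) = P.coeff 0 + P.coeff 1 * n + Complex.I * (Q.eval (n : ℚ) : ℚ) := by
    choose! q hq using h
    refine ⟨∑ k ∈ Finset.Ico 2 (P.natDegree + 1), C (q k) * X ^ k,
      hP.trans (le_natDegree_of_ne_zero ?_), fun n => ?_⟩
    · simp only [finsetSum_coeff, coeff_C_mul, coeff_X_pow, mul_ite, mul_one, mul_zero,
        Finset.sum_ite_eq, Finset.mem_Ico]
      rw [if_pos (by omega)]
      intro h0
      have := hq _ hP
      rw [h0, Rat.cast_zero, mul_zero, coeff_natDegree, leadingCoeff_eq_zero] at this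
      simp [this] at hP
    · rw [eval_eq_sum_range, ← Finset.sum_range_add_sum_Ico _ (show 2 ≤ P.natDegree + 1 by omega),
        Finset.sum_range_succ, Finset.sum_range_one, pow_zero, mul_one, pow_one]
      congr 1
      simp only [eval_finsetSum, eval_mul, eval_C, eval_pow, eval_X]
      push_cast
      rw [Finset.mul_sum]
      refine Finset.sum_congr rfl fun k hk => ?_
      rw [hq k (Finset.mem_Ico.1 hk).1, mul_assoc]
  obtain ⟨E, R, hE, hR⟩ := Q.exists_int_eval_eq_mul
  obtain ⟨m, hm⟩ := exists_eval_add_two_sub_ne hQd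
  set Δ : ℤ := R.eval ((m + 2 : ℕ) : ℤ) - R.eval (m : ℤ) - (R.eval ((2 : ℕ) : ℤ) - R.eval ((0 : ℕ) : ℤ))
    with hΔ
  have hΔ0 : Δ ≠ 0 := by
    intro h0
    have : (Δ : ℚ) = 0 := by exact_mod_cast h0
    rw [hΔ] at this
    simp only [Int.cast_sub, hR, ← mul_sub] at this
    have := (mul_eq_zero.1 this).resolve_left (by exact_mod_cast hE.ne')
    push_cast at this
    exact hm (sub_eq_zero.1 this)
  -- `M > m` allows the recursion at index `m`; `M > |Δ|` excludes `M ∣ Δ`.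
  set M : ℕ := m + Δ.natAbs + 1 with hM
  have hM0 : M ≠ 0 := by omega
  have hMC : (M : ℂ) ≠ 0 := by exact_mod_cast hM0
  -- This time turns the phase `t * Q(n)` into `2π R(n) / M`.
  set t : ℝ≥0 := 2 * NNReal.pi * E / M with ht
  have htC : ((t : ℝ) : ℂ) = 2 * Real.pi * E / M := by rw [ht]; push_cast [NNReal.coe_real_pi]; rfl
  set u : ℕ → ℂ := fun n =>
    Complex.exp (2 * Real.pi * Complex.I * ((R.eval (n : ℤ) : ℤ) / M)) with hu
  have huM (n : ℕ) : u (n + M) = u n := exp_eval_div_periodic R hM0 n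
  set b := Complex.exp (t * P.coeff 1) with hb
  have hexp (n : ℕ) : Complex.exp (t * P.eval (n : ℂ)) = Complex.exp (t * P.coeff 0) * b ^ n * u n := by
    have hRn : ((R.eval (n : ℤ) : ℤ) : ℂ) = E * (Q.eval (n : ℚ) : ℚ) := by exact_mod_cast hR n
    rw [hb, hu, ← Complex.exp_nat_mul, ← Complex.exp_add, ← Complex.exp_add, hQ, hRn]
    congr 1
    rw [htC]
    ring
  have hb0 : b ≠ 0 := Complex.exp_ne_zero _
  obtain ⟨c, hc⟩ := exists_sq_eq_of_im_eq_zero hb0 hM0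
  have key (n : ℕ) (hn : n < M) : u n = c * u (n + 2) := by
    refine eq_mul_shift_two_of_periodic huM (fun ζ hζ => ?_) hn
    by_cases him : (ζ / b).im = 0
    · rw [hc ζ hζ him, sub_self, zero_mul]
    -- Dividing `ζ` by `b` cancels the factor `b ^ n` from the linear term of `P`.
    obtain ⟨f, hf⟩ := exists_taylorCoeff_eq_pow him
    have hTf (n : ℕ) : taylorCoeff n (T.op t f) = Complex.exp (t * P.coeff 0) * (u n * ζ ^ n) := by
      rw [hT.apply_op_eq_exp (continuous_taylorCoeff n)
        (fun f => taylorCoeff_aeval_eulerOp P f n), hexp, hf, div_pow]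
      field_simp
    have hsum := sum_taylorCoeff_eq_zero (f := T.op t f) (M := M) fun n => by
      rw [hTf, hTf, huM, pow_add, hζ, mul_one]
    simp_rw [hTf] at hsum
    rw [← Finset.mul_sum] at hsum
    rw [(mul_eq_zero.1 hsum).resolve_left (Complex.exp_ne_zero _), mul_zero]
  have k0 := key 0 (by omega)
  have k1 := key m (by omega)
  -- The unknown `c` is eliminated; comparing exponents then gives `M ∣ Δ`.
  have hcu : u 0 * u (m + 2) = u m * u 2 := by
    rw [k0, k1, zero_add]
    ring
  simp only [hu, ← Complex.exp_add] at hcu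
  obtain ⟨k, hk⟩ := Complex.exp_eq_exp_iff_exists_int.1 hcu
  have hdvd : Δ = M * k := by
    have h2 : (2 * Real.pi * Complex.I : ℂ) ≠ 0 := Complex.two_pi_I_ne_zero
    have : (Δ : ℂ) = M * k := by
      refine mul_left_cancel₀ h2 ?_
      rw [hΔ]
      field_simp at hk
      push_cast at hk ⊢
      linear_combination (exp := 1) 2 * Real.pi * Complex.I * hk
    exact_mod_cast this
  have hle := Nat.le_of_dvd (Int.natAbs_pos.2 hΔ0) (Int.natCast_dvd.1 ⟨k, hdvd⟩)
  omega

theorem not_generatesC0Semigroup_of_re_pos {P : ℂ[X]} {l : ℕ} (hl : 2 ≤ l)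
    (hpos : 0 < (P.coeff l).re) (hzero : ∀ k, l < k → (P.coeff k).re = 0) :
    ¬ GeneratesC0Semigroup (aeval (R := ℂ) (A := Module.End ℂ RealAnalyticSpace) eulerOp P) := by
  rintro ⟨T, hT⟩
  obtain ⟨f, hf⟩ := exists_taylorCoeff_eq_exp_neg_eval hl hpos hzero
  have hTf (n : ℕ) : taylorCoeff n (T.op 1 f) = 1 := by
    rw [hT.apply_op_eq_exp (continuous_taylorCoeff n)
      (fun f => taylorCoeff_aeval_eulerOp P f n), hf, ← Complex.exp_add]
    simp
  -- Coefficients all equal to `1` have period one, with sum `1` over a period.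
  have := sum_taylorCoeff_eq_zero (f := T.op 1 f) (M := 1) fun n => by rw [hTf, hTf]
  simp [hTf] at this

theorem mainTheorem3 (P : ℂ[X]) (hP : 2 ≤ P.natDegree)
    (h : (∃ l : ℕ, 2 ≤ l ∧ 0 < (P.coeff l).re ∧ ∀ k, l < k → (P.coeff k).re = 0) ∨
      (∀ k, 2 ≤ k → ∃ q : ℚ, P.coeff k = Complex.I * (q : ℂ))) :
    ¬ GeneratesC0Semigroup (aeval (R := ℂ) (A := Module.End ℂ RealAnalyticSpace) eulerOp P) := by
  rcases h with ⟨l, hl, hpos, hzero⟩ | h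
  · exact not_generatesC0Semigroup_of_re_pos hl hpos hzero
  · exact not_generatesC0Semigroup_of_rational hP h
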